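/- Let $n,m_1,m_2,s_1,s_2$ be nonnegative integers. For $u,v\in\mathbb{C}^n$ let $u\circledast v\in\mathbb{C}^n$ denote their circular convolution, $(u\circledast v)^{(k)}=\sum_{j}u^{(j)}v^{(k-j)}$ with indices modulo $n$, and let $\|x\|_0$ denote the number of nonzero entries of $x$. Consider the following three choices of constraint sets $\Omega_{\mathcal X}\subset\mathbb{C}^{m_1}$, $\Omega_{\mathcal Y}\subset\mathbb{C}^{m_2}$ and of a number $d$: 1. (subspace constraints) $\Omega_{\mathcal X}=\mathbb{C}^{m_1}$, $\Omega_{\mathcal Y}=\mathbb{C}^{m_2}$, $d=m_1+m_2$; 2. (mixed constraints) $\Omega_{\mathcal X}=\{x\in\mathbb{C}^{m_1}:\|x\|_0\le s_1\}$, $\Omega_{\mathcal Y}=\mathbb{C}^{m_2}$, $d=s_1+m_2$; 3. (sparsity constraints) $\Omega_{\mathcal X}=\{x\in\mathbb{C}^{m_1}:\|x\|_0\le s_1\}$, $\Omega_{\mathcal Y}=\{y\in\mathbb{C}^{m_2}:\|y\|_0\le s_2\}$, $d=s_1+s_2$. In each of the three cases, if $n>d$, then for every fixed pair $(x_0,y_0)\in\Omega_{\mathcal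 X}\times\Omega_{\mathcal Y}$ with $x_0\neq0$ and $y_0\neq0$ the following holds for all pairs of matrices $(D,E)\in\mathbb{C}^{n\times m_1}\times\mathbb{C}^{n\times m_2}$ outside a set of Lebesgue measure zero (which may depend on $(x_0,y_0)$): $(x_0,y_0)$ is identifiable up to scaling, i.e. every $(x,y)\in\Omega_{\mathcal X}\times\Omega_{\mathcal Y}$ with $(Dx)\circledast(Ey)=(Dx_0)\circledast(Ey_0)$ satisfies $x=\sigma x_0$ and $y=\frac1\sigma y_0$ for some nonzero $\sigma\in\mathbb{C}$. -/

import Mathlib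

open MeasureTheory Matrix

namespace BlindDeconv

/-- Circular convolution of two vectors of `ℂⁿ`: `(u ⊛ v)⁽ᵏ⁾ = ∑ⱼ u⁽ʲ⁾ v⁽ᵏ⁻ʲ⁾`, where the
subtraction of indices in `Fin n` is modulo `n`. -/
def circConv {n : ℕ} (u v : Fin n → ℂ) : Fin n → ℂ :=
  fun k => ∑ j, u j * v (k - j)

/-- The constraint set of a subspace constraint: all of `ℂᵐ`. -/
def subspaceSet (m : ℕ) : Set (Fin m → ℂ) :=
  Set.univ

/-- The constraint set of a sparsity constraint: the vectors of `ℂᵐ` with at most `s` nonzero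
entries. -/
def sparseSet (m s : ℕ) : Set (Fin m → ℂ) :=
  {x | hammingNorm x ≤ s}

/-- `(x, y)` solves the blind deconvolution problem with measurement `z`:
`(D x) ⊛ (E y) = z`, `x ∈ ΩX`, `y ∈ ΩY`. -/
def IsSolution {n m₁ m₂ : ℕ} (D : Matrix (Fin n) (Fin m₁) ℂ) (E : Matrix (Fin n) (Fin m₂) ℂ)
    (ΩX : Set (Fin m₁ → ℂ)) (ΩY : Set (Fin m₂ → ℂ)) (z : Fin n → ℂ)
    (x : Fin m₁ → ℂ) (y : Fin m₂ → ℂ) : Prop :=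
  circConv (D *ᵥ x) (E *ᵥ y) = z ∧ x ∈ ΩX ∧ y ∈ ΩY

/-- The pair `(x₀, y₀)` is identifiable up to scaling: every solution `(x, y)` of the blind
deconvolution problem with measurement `z = (D x₀) ⊛ (E y₀)` has the form `(σ x₀, σ⁻¹ y₀)` for
some nonzero `σ`. -/
def IdentifiableUpToScaling {n m₁ m₂ : ℕ}
    (D : Matrix (Fin n) (Fin m₁) ℂ) (E : Matrix (Fin n) (Fin m₂) ℂ)
    (ΩX : Set (Fin m₁ → ℂ)) (ΩY : Set (Fin m₂ → ℂ))
    (x₀ : Fin m₁ → ℂ) (y₀ : Fin m₂ → ℂ) : Prop :=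
  ∀ (x : Fin m₁ → ℂ) (y : Fin m₂ → ℂ),
    IsSolution D E ΩX ΩY (circConv (D *ᵥ x₀) (E *ᵥ y₀)) x y →
      ∃ σ : ℂ, σ ≠ 0 ∧ x = σ • x₀ ∧ y = σ⁻¹ • y₀

/-- Weak identifiability for almost all `D ∈ ℂ^{n × m₁}` and `E ∈ ℂ^{n × m₂}`: for every fixed
pair `(x₀, y₀) ∈ ΩX × ΩY` of nonzero vectors, the set of pairs `(D, E)` for which `(x₀, y₀)` is not
identifiable up to scaling has Lebesgue measure zero (the null set may depend on `(x₀, y₀)`).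
The pair of matrices is given by its arrays of entries, which carry the Lebesgue measure. -/
def GenericallyWeaklyIdentifiable (n : ℕ) {m₁ m₂ : ℕ}
    (ΩX : Set (Fin m₁ → ℂ)) (ΩY : Set (Fin m₂ → ℂ)) : Prop :=
  ∀ x₀ ∈ ΩX, ∀ y₀ ∈ ΩY, x₀ ≠ 0 → y₀ ≠ 0 →
    ∀ᵐ p : (Fin n → Fin m₁ → ℂ) × (Fin n → Fin m₂ → ℂ) ∂volume,
      IdentifiableUpToScaling (Matrix.of p.1) (Matrix.of p.2) ΩX ΩY x₀ y₀

end BlindDeconv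

/-!
A subspace constraint is a sparsity constraint (`subspaceSet m = sparseSet m m`), so only the
sparse case has to be treated. The discrete Fourier transform turns circular convolution into a
pointwise product, and it acts on pairs of matrices as an invertible linear map, which preserves
null sets. With `A`, `B` the transformed matrices and `A k`, `B k` their rows, the equations become
`(A k ⬝ x) (B k ⬝ y) = (A k ⬝ x₀) (B k ⬝ y₀)` for all `k`.

For fixed `A`, `x`, `y` the `k`-th equation is linear in `B k`: it says that `B k` annihilates
`w k = (A k ⬝ x) y - (A k ⬝ x₀) y₀`. If no `w k` vanishes, each equation determines one entry of
`B` from the others, so `B` loses `n` degrees of freedom, whereas the choice of `x` and `y` with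
given supports adds at most `s₁ + s₂ < n`. Hence such solutions exist only for a null set of
`(A, B)`. This dimension count is `ae_elimination`: the values of the extra parameters can be stored
in the eliminated entries of `B`, at least one of which remains unused, and this exhibits the bad
set as the image of a null hyperplane under a differentiable self-map of the space of pairs of
matrices.

So almost surely every solution has `w k = 0` for some `k` (`ae_exists_smul_eq_smul`). As all
`A k ⬝ x₀` and `B k ⬝ y₀` are almost surely nonzero, this forces `y = σ⁻¹ y₀` with `σ ≠ 0`.
Cancelling `B k ⬝ y₀` leaves `A k ⬝ (σ⁻¹ x) = A k ⬝ x₀` for all `k`, whence `σ⁻¹ x = x₀` by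
another application of the dimension count (`ae_eq_of_dotProduct_eq`).
-/

namespace BlindDeconv

/-! ### Null sets in spaces of matrices -/

theorem ae_linearMap_ne_zero {E : Type*} [NormedAddCommGroup E] [NormedSpace ℝ E]
    [FiniteDimensional ℝ E] [MeasurableSpace E] [BorelSpace E] (μ : Measure E)
    [μ.IsAddHaarMeasure] (ℓ : E →ₗ[ℝ] ℂ) (hℓ : ℓ ≠ 0) : ∀ᵐ p ∂μ, ℓ p ≠ 0 := by
  have h := Measure.addHaar_submodule μ (LinearMap.ker ℓ) (by simpa [LinearMap.ker_eq_top] using hℓ)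
  rw [ae_iff]
  simpa using measure_mono_null (fun p hp => by simpa using hp) h

/-- The Lebesgue measure on pairs of matrices is a Haar measure; instance search does not find this
because it does not see through `volume` on nested products. -/
theorem isAddHaarMeasure_volume_matrixPair {n m₁ m₂ : ℕ} :
    (volume : Measure ((Fin n → Fin m₁ → ℂ) × (Fin n → Fin m₂ → ℂ))).IsAddHaarMeasure :=
  have (m : ℕ) : (volume : Measure (Fin n → Fin m → ℂ)).IsAddHaarMeasure :=
    Measure.pi.isAddHaarMeasure fun _ : Fin n => (volume : Measure (Fin m → ℂ))
  Measure.prod.instIsAddHaarMeasure _ _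

theorem ae_comp_linearEquiv {E : Type*} [NormedAddCommGroup E] [NormedSpace ℝ E]
    [FiniteDimensional ℝ E] [MeasurableSpace E] [BorelSpace E] (μ : Measure E)
    [μ.IsAddHaarMeasure] (e : E ≃ₗ[ℝ] E) {P : E → Prop} (h : ∀ᵐ q ∂μ, P q) :
    ∀ᵐ p ∂μ, P (e p) := by
  rw [ae_iff] at h ⊢
  have := Measure.addHaar_preimage_linearMap μ (f := (e : E →ₗ[ℝ] E))
    (LinearEquiv.isUnit_det' e).ne_zero
    {q | ¬ P q}
  rw [h, mul_zero] at this
  exact this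

/-! ### The dimension count -/

/-- Dimension count: let vectors `w A t k` depend differentiably on a matrix `A` and on fewer than
`n` complex parameters `t`. For almost all `(A, B)` there is no `t` for which all `n` vectors
`w A t k` are nonzero and annihilated by the corresponding rows of `B`. -/
theorem ae_elimination {n m m' : ℕ} {τ : Type*} [Fintype τ] (hτ : Fintype.card τ < n)
    (w : (Fin n → Fin m' → ℂ) → (τ → ℂ) → Fin n → Fin m → ℂ)
    (hw : Differentiable ℝ fun p : (Fin n → Fin m' → ℂ) × (τ → ℂ) => w p.1 p.2) :
    ∀ᵐ p : (Fin n → Fin m' → ℂ) × (Fin n → Fin m → ℂ),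
      ∀ t : τ → ℂ, (∀ k, w p.1 t k ≠ 0) → ∃ k, p.2 k ⬝ᵥ w p.1 t k ≠ 0 := by
  classical
  obtain ⟨ι⟩ : Nonempty (τ ↪ Fin n) :=
    Function.Embedding.nonempty_of_card_le (by simpa using hτ.le)
  obtain ⟨k₀, hk₀⟩ : ∃ k₀, k₀ ∉ Set.range ι := by
    by_contra! h
    have := Fintype.card_le_of_surjective ι h
    simp at this
    omega
  -- It suffices to consider a fixed choice `j k` of a nonzero coordinate of each `w A t k`.
  have key : ∀ j : Fin n → Fin m, ∀ᵐ p : (Fin n → Fin m' → ℂ) × (Fin n → Fin m → ℂ),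
      ∀ t : τ → ℂ, (∀ k, w p.1 t k (j k) ≠ 0) → ∃ k, p.2 k ⬝ᵥ w p.1 t k ≠ 0 := by
    intro j
    -- `W` reads the parameters `t` off the entries `(ι i, j (ι i))` of the second matrix; `Φ` then
    -- replaces all entries `(k, j k)` by the values that make row `k` annihilate `W p k`.
    let W : (Fin n → Fin m' → ℂ) × (Fin n → Fin m → ℂ) → Fin n → Fin m → ℂ :=
      fun p => w p.1 fun i => p.2 (ι i) (j (ι i))
    let Φ : (Fin n → Fin m' → ℂ) × (Fin n → Fin m → ℂ) →
        (Fin n → Fin m' → ℂ) × (Fin n → Fin m → ℂ) := fun p =>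
      (p.1, fun k i => p.2 k i - if i = j k then (∑ l, p.2 k l * W p k l) / W p k (j k) else 0)
    -- The entry `(k₀, j k₀)` is not used to store a parameter, so it may be taken to be zero.
    let s : Set ((Fin n → Fin m' → ℂ) × (Fin n → Fin m → ℂ)) :=
      {p | p.2 k₀ (j k₀) = 0 ∧ ∀ k, W p k (j k) ≠ 0}
    have hW : Differentiable ℝ W :=
      hw.comp (g := fun p : (Fin n → Fin m' → ℂ) × (τ → ℂ) => w p.1 p.2)
        (f := fun p : (Fin n → Fin m' → ℂ) × (Fin n → Fin m → ℂ) =>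
          (p.1, fun i => p.2 (ι i) (j (ι i))))
        (by fun_prop)
    have hWki : ∀ k i, Differentiable ℝ fun p => W p k i := by
      intro k i; fun_prop
    have hΦ : DifferentiableOn ℝ Φ s := by
      intro p hp
      apply DifferentiableAt.differentiableWithinAt
      refine differentiableAt_fst.prodMk ?_
      rw [differentiableAt_pi]; intro k
      rw [differentiableAt_pi]; intro i
      have hne := hp.2 k
      by_cases hi : i = j k
      · simp only [hi, if_true, div_eq_mul_inv]
        refine DifferentiableAt.fun_sub (by fun_prop)
          (DifferentiableAt.fun_mul ?_ ((hWki k (j k) p).fun_inv hne))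
        exact DifferentiableAt.fun_sum fun l _ =>
          DifferentiableAt.fun_mul (by fun_prop) (hWki k l p)
      · simp only [hi, if_false]; fun_prop
    have := isAddHaarMeasure_volume_matrixPair (n := n) (m₁ := m') (m₂ := m)
    have hs : volume s = 0 := by
      let ℓ : ((Fin n → Fin m' → ℂ) × (Fin n → Fin m → ℂ)) →ₗ[ℝ] ℂ :=
        { toFun := fun p => p.2 k₀ (j k₀), map_add' := by simp, map_smul' := by simp }
      have hℓ : ℓ ≠ 0 := by
        intro h
        simpa [ℓ] using LinearMap.congr_fun h (0, fun _ _ => 1)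
      have h := ae_linearMap_ne_zero volume ℓ hℓ
      rw [ae_iff] at h
      refine measure_mono_null (fun p hp => ?_) h
      simpa [ℓ] using hp.1
    have hnull := addHaar_image_eq_zero_of_differentiableOn_of_addHaar_eq_zero volume hΦ hs
    rw [ae_iff]
    refine measure_mono_null (fun p hp => ?_) hnull
    simp only [Set.mem_ofPred_eq, not_forall, not_exists, not_not] at hp
    obtain ⟨t, hne, horth⟩ := hp
    -- A bad `p` is the image of the point `q` obtained by storing `t` in the eliminated entries.
    let q : (Fin n → Fin m' → ℂ) × (Fin n → Fin m → ℂ) := (p.1, fun k i =>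
      if i = j k then (if h : ∃ a, ι a = k then t h.choose else 0) else p.2 k i)
    have hqt : (fun i => q.2 (ι i) (j (ι i))) = t := by
      funext a
      have h : ∃ b, ι b = ι a := ⟨a, rfl⟩
      simp only [q, if_true, dif_pos h]
      exact congrArg t (ι.injective h.choose_spec)
    have hWq : W q = w p.1 t := by simp only [W, hqt]; rfl
    refine ⟨q, ⟨?_, by simpa only [hWq] using hne⟩, ?_⟩
    · have h : ¬ ∃ a, ι a = k₀ := fun ⟨a, ha⟩ => hk₀ ⟨a, ha⟩
      simp only [q, if_true, dif_neg h]
    · refine Prod.ext rfl ?_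
      funext k i
      simp only [Φ, hWq]
      by_cases hi : i = j k
      · subst hi
        have ho := horth k
        have hk := hne k
        simp only [dotProduct] at ho
        rw [← Finset.add_sum_erase _ _ (Finset.mem_univ (j k))] at ho ⊢
        have hsum : ∑ x ∈ Finset.univ.erase (j k), q.2 k x * w p.1 t k x =
            ∑ x ∈ Finset.univ.erase (j k), p.2 k x * w p.1 t k x :=
          Finset.sum_congr rfl fun x hx => by simp [q, Finset.ne_of_mem_erase hx]
        rw [hsum, if_pos rfl]
        field_simp
        linear_combination -ho
      · simp [hi, q]
  filter_upwards [ae_all_iff.2 key] with p hp t ht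
  choose j hj using fun k => Function.ne_iff.1 (ht k)
  exact hp j t hj

/-! ### Passage to the Fourier domain -/

theorem dft_circConv {N : ℕ} [NeZero N] (u v : ZMod N → ℂ) :
    ZMod.dft (fun k => ∑ j, u j * v (k - j)) = fun k => ZMod.dft u k * ZMod.dft v k := by
  funext k
  simp only [ZMod.dft_apply, smul_eq_mul, Finset.mul_sum, Finset.sum_mul]
  rw [Finset.sum_comm]
  conv_rhs => rw [Finset.sum_comm]
  refine Finset.sum_congr rfl fun j _ => ?_
  refine Fintype.sum_equiv (Equiv.subRight j) _ _ fun i => ?_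
  have : -(i * k) = -(j * k) + -((i - j) * k) := by ring
  simp only [Equiv.subRight_apply]
  rw [this, AddChar.map_add_eq_mul]
  ring

theorem dft_mulVec {N m : ℕ} [NeZero N] (D : ZMod N → Fin m → ℂ) (x : Fin m → ℂ) (k : ZMod N) :
    ZMod.dft (fun i => D i ⬝ᵥ x) k = ZMod.dft D k ⬝ᵥ x := by
  simp only [ZMod.dft_apply, sum_dotProduct, smul_dotProduct]


/-- Identifiability up to scaling in the Fourier domain, where the measurement of `(x, y)` is the
pointwise product `k ↦ (A k ⬝ᵥ x) * (B k ⬝ᵥ y)`. -/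
def FourierIdentifiable {ι : Type*} {m₁ m₂ : ℕ} (A : ι → Fin m₁ → ℂ) (B : ι → Fin m₂ → ℂ)
    (ΩX : Set (Fin m₁ → ℂ)) (ΩY : Set (Fin m₂ → ℂ))
    (x₀ : Fin m₁ → ℂ) (y₀ : Fin m₂ → ℂ) : Prop :=
  ∀ x ∈ ΩX, ∀ y ∈ ΩY,
    (∀ k, (A k ⬝ᵥ x) * (B k ⬝ᵥ y) = (A k ⬝ᵥ x₀) * (B k ⬝ᵥ y₀)) →
      ∃ σ : ℂ, σ ≠ 0 ∧ x = σ • x₀ ∧ y = σ⁻¹ • y₀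

/-- The discrete Fourier transform is taken along the row index of the matrices, which is possible
because `Fin (N + 1)` and `ZMod (N + 1)` agree by definition. -/
theorem FourierIdentifiable.identifiable {N m₁ m₂ : ℕ}
    {D : Fin (N + 1) → Fin m₁ → ℂ} {E : Fin (N + 1) → Fin m₂ → ℂ}
    {ΩX : Set (Fin m₁ → ℂ)} {ΩY : Set (Fin m₂ → ℂ)} {x₀ : Fin m₁ → ℂ} {y₀ : Fin m₂ → ℂ}
    (h : FourierIdentifiable (ι := ZMod (N + 1)) (ZMod.dft (N := N + 1) D) (ZMod.dft (N := N + 1) E)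
      ΩX ΩY x₀ y₀) :
    IdentifiableUpToScaling (Matrix.of D) (Matrix.of E) ΩX ΩY x₀ y₀ := by
  rintro x y ⟨heq, hx, hy⟩
  have hdft : ∀ (x : Fin m₁ → ℂ) (y : Fin m₂ → ℂ) (k : ZMod (N + 1)),
      ZMod.dft (N := N + 1) (circConv (Matrix.of D *ᵥ x) (Matrix.of E *ᵥ y)) k =
        (ZMod.dft (N := N + 1) D k ⬝ᵥ x) * (ZMod.dft (N := N + 1) E k ⬝ᵥ y) := fun x y k =>
    (congrFun (dft_circConv (N := N + 1) (Matrix.of D *ᵥ x) (Matrix.of E *ᵥ y)) k).trans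
      (congrArg₂ (· * ·) (dft_mulVec (N := N + 1) D x k) (dft_mulVec (N := N + 1) E y k))
  exact h x hx y hy fun k => (hdft x y k).symm.trans <|
    (congrArg (fun z => ZMod.dft (N := N + 1) z k) heq).trans (hdft x₀ y₀ k)

/-! ### Identifiability in the Fourier domain -/

theorem ae_dotProduct_ne_zero {n m m' : ℕ} {x₀ : Fin m → ℂ} (hx₀ : x₀ ≠ 0) (k : Fin n) :
    ∀ᵐ p : (Fin n → Fin m → ℂ) × (Fin n → Fin m' → ℂ), p.1 k ⬝ᵥ x₀ ≠ 0 := by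
  have := isAddHaarMeasure_volume_matrixPair (n := n) (m₁ := m) (m₂ := m')
  let ℓ : ((Fin n → Fin m → ℂ) × (Fin n → Fin m' → ℂ)) →ₗ[ℝ] ℂ :=
    { toFun := fun p => p.1 k ⬝ᵥ x₀
      map_add' := by simp [add_dotProduct]
      map_smul' := by simp [smul_dotProduct] }
  refine ae_linearMap_ne_zero volume ℓ fun h => ?_
  obtain ⟨i, hi⟩ := Function.ne_iff.1 hx₀
  exact hi (by simpa [ℓ] using LinearMap.congr_fun h (fun _ => Pi.single i 1, 0))

/-- Extension by zero of a vector indexed by `S`, which parametrises the vectors supported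
in `S`. -/
noncomputable def extendByZero {m : ℕ} (S : Finset (Fin m)) : (S → ℂ) →ₗ[ℂ] (Fin m → ℂ) :=
  Function.ExtendByZero.linearMap ℂ Subtype.val

theorem exists_extendByZero_eq {m : ℕ} {S : Finset (Fin m)} {x : Fin m → ℂ}
    (hx : ∀ i ∉ S, x i = 0) : ∃ t, extendByZero S t = x := by
  refine ⟨fun i => x i, funext fun i => ?_⟩
  simp only [extendByZero, Function.ExtendByZero.linearMap_apply]
  by_cases hi : i ∈ S
  · exact Subtype.val_injective.extend_apply (fun i : S => x i) 0 (⟨i, hi⟩ : S)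
  · rw [Function.extend_apply' _ _ _ (by simpa using hi), hx i hi, Pi.zero_apply]

theorem differentiable_extendByZero {m : ℕ} (S : Finset (Fin m)) :
    Differentiable ℝ (extendByZero S) :=
  ((extendByZero S).restrictScalars ℝ).toContinuousLinearMap.differentiable

/-- Almost every `A` separates a fixed vector `x₀`, sparse or not, from all `s`-sparse vectors. -/
theorem ae_eq_of_dotProduct_eq {n m m' s : ℕ} (hs : s < n) (x₀ : Fin m → ℂ) :
    ∀ᵐ p : (Fin n → Fin m → ℂ) × (Fin n → Fin m' → ℂ), ∀ x ∈ sparseSet m s,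
      (∀ k, p.1 k ⬝ᵥ x = p.1 k ⬝ᵥ x₀) → x = x₀ := by
  have key : ∀ S : {S : Finset (Fin m) // S.card ≤ s},
      ∀ᵐ p : (Fin n → Fin m' → ℂ) × (Fin n → Fin m → ℂ), ∀ t : S.1 → ℂ,
        (∀ _ : Fin n, extendByZero S.1 t - x₀ ≠ 0) →
          ∃ k, p.2 k ⬝ᵥ (extendByZero S.1 t - x₀) ≠ 0 := by
    -- Here the vectors `w` depend neither on the other matrix nor on the row index.
    intro S
    refine ae_elimination (m' := m') (by simpa using S.2.trans_lt hs)
      (fun _ t _ => extendByZero S.1 t - x₀) ?_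
    have := differentiable_extendByZero S.1
    fun_prop
  have hswap := (Measure.measurePreserving_swap (μ := (volume : Measure (Fin n → Fin m → ℂ)))
    (ν := (volume : Measure (Fin n → Fin m' → ℂ)))).quasiMeasurePreserving.ae (ae_all_iff.2 key)
  filter_upwards [hswap] with p hp x hx hk
  obtain ⟨t, ht⟩ := exists_extendByZero_eq (S := Finset.univ.filter (x · ≠ 0)) (x := x) (by simp)
  by_contra hne
  obtain ⟨k, hk'⟩ := hp ⟨Finset.univ.filter (x · ≠ 0), hx⟩ t
    fun _ => by rw [ht]; exact sub_ne_zero.2 hne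
  exact hk' (by rw [ht]; simp [dotProduct_sub, hk k])

/-- Almost surely, every solution has a vanishing vector `(A k ⬝ x) y - (A k ⬝ x₀) y₀`. For
nonzero `A k ⬝ x` this makes `y` and `y₀` parallel. -/
theorem ae_exists_smul_eq_smul {n m₁ m₂ s₁ s₂ : ℕ} (hs : s₁ + s₂ < n)
    (x₀ : Fin m₁ → ℂ) (y₀ : Fin m₂ → ℂ) :
    ∀ᵐ p : (Fin n → Fin m₁ → ℂ) × (Fin n → Fin m₂ → ℂ),
      ∀ x ∈ sparseSet m₁ s₁, ∀ y ∈ sparseSet m₂ s₂,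
        (∀ k, (p.1 k ⬝ᵥ x) * (p.2 k ⬝ᵥ y) = (p.1 k ⬝ᵥ x₀) * (p.2 k ⬝ᵥ y₀)) →
          ∃ k, (p.1 k ⬝ᵥ x) • y = (p.1 k ⬝ᵥ x₀) • y₀ := by
  have key : ∀ S : {S : Finset (Fin m₁) // S.card ≤ s₁},
      ∀ T : {T : Finset (Fin m₂) // T.card ≤ s₂},
      ∀ᵐ p : (Fin n → Fin m₁ → ℂ) × (Fin n → Fin m₂ → ℂ), ∀ t : S.1 ⊕ T.1 → ℂ,
        (∀ k, (p.1 k ⬝ᵥ extendByZero S.1 (t ∘ Sum.inl)) • extendByZero T.1 (t ∘ Sum.inr)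
            - (p.1 k ⬝ᵥ x₀) • y₀ ≠ 0) →
          ∃ k, p.2 k ⬝ᵥ ((p.1 k ⬝ᵥ extendByZero S.1 (t ∘ Sum.inl)) •
              extendByZero T.1 (t ∘ Sum.inr)
            - (p.1 k ⬝ᵥ x₀) • y₀) ≠ 0 := by
    intro S T
    refine ae_elimination (by simpa using (add_le_add S.2 T.2).trans_lt hs)
      (fun A t k => (A k ⬝ᵥ extendByZero S.1 (t ∘ Sum.inl)) • extendByZero T.1 (t ∘ Sum.inr)
            - (A k ⬝ᵥ x₀) • y₀) ?_
    have hS := differentiable_extendByZero S.1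
    have hT := differentiable_extendByZero T.1
    simp only [dotProduct, Function.comp_def]
    fun_prop
  filter_upwards [ae_all_iff.2 fun S => ae_all_iff.2 (key S)] with p hp x hx y hy hk
  obtain ⟨t, ht⟩ := exists_extendByZero_eq (S := Finset.univ.filter (x · ≠ 0)) (x := x) (by simp)
  obtain ⟨u, hu⟩ := exists_extendByZero_eq (S := Finset.univ.filter (y · ≠ 0)) (x := y) (by simp)
  by_contra! hne
  obtain ⟨k, hk'⟩ := hp ⟨_, hx⟩ ⟨_, hy⟩ (Sum.elim t u)
    fun k => by
      rw [Sum.elim_comp_inl, Sum.elim_comp_inr]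
      exact sub_ne_zero.2 (by rw [ht, hu]; exact hne k)
  rw [Sum.elim_comp_inl, Sum.elim_comp_inr] at hk'
  refine hk' ?_
  rw [ht, hu]
  simp [dotProduct_sub, hk k]

theorem ae_fourierIdentifiable {n m₁ m₂ s₁ s₂ : ℕ} (hs : s₁ + s₂ < n)
    {x₀ : Fin m₁ → ℂ} {y₀ : Fin m₂ → ℂ} (hx₀ : x₀ ≠ 0) (hy₀ : y₀ ≠ 0) :
    ∀ᵐ p : (Fin n → Fin m₁ → ℂ) × (Fin n → Fin m₂ → ℂ),
      FourierIdentifiable p.1 p.2 (sparseSet m₁ s₁) (sparseSet m₂ s₂) x₀ y₀ := by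
  have hy : ∀ k : Fin n, ∀ᵐ p : (Fin n → Fin m₁ → ℂ) × (Fin n → Fin m₂ → ℂ),
      p.2 k ⬝ᵥ y₀ ≠ 0 := fun k =>
    (Measure.measurePreserving_swap (μ := (volume : Measure (Fin n → Fin m₁ → ℂ)))
      (ν := (volume : Measure (Fin n → Fin m₂ → ℂ)))).quasiMeasurePreserving.ae
        (ae_dotProduct_ne_zero (m' := m₁) hy₀ k)
  filter_upwards [ae_all_iff.2 fun k => ae_dotProduct_ne_zero (n := n) (m' := m₂) hx₀ k,
    ae_all_iff.2 hy, ae_eq_of_dotProduct_eq (m' := m₂) (by omega : s₁ < n) x₀,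
    ae_exists_smul_eq_smul hs x₀ y₀] with p hA hB hinj hpar x hx y hy h
  obtain ⟨k₀, hk₀⟩ := hpar x hx y hy h
  have hax : p.1 k₀ ⬝ᵥ x ≠ 0 := by
    intro h0
    have := h k₀
    rw [h0, zero_mul] at this
    exact mul_ne_zero (hA k₀) (hB k₀) this.symm
  set σ : ℂ := (p.1 k₀ ⬝ᵥ x) / (p.1 k₀ ⬝ᵥ x₀) with hσ
  have hσ0 : σ ≠ 0 := div_ne_zero hax (hA k₀)
  have hyσ : y = σ⁻¹ • y₀ := by
    rw [hσ, inv_div, div_eq_inv_mul, mul_smul, ← hk₀, inv_smul_smul₀ hax]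
  have hxσ : σ⁻¹ • x = x₀ := by
    refine hinj _ ?_ fun k => ?_
    · exact hammingNorm_smul_le_hammingNorm.trans hx
    · have := h k
      rw [hyσ, dotProduct_smul, smul_eq_mul, ← mul_assoc] at this
      rw [dotProduct_smul, smul_eq_mul, mul_comm]
      exact mul_right_cancel₀ (hB k) this
  exact ⟨σ, hσ0, by rw [← hxσ, smul_inv_smul₀ hσ0], hyσ⟩

/-! ### Identifiability for generic matrices -/

theorem genericallyWeaklyIdentifiable_sparseSet {n m₁ m₂ s₁ s₂ : ℕ} (hs : s₁ + s₂ < n) :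
    GenericallyWeaklyIdentifiable n (sparseSet m₁ s₁) (sparseSet m₂ s₂) := by
  intro x₀ _ y₀ _ hx₀ hy₀
  obtain ⟨N, rfl⟩ : ∃ N, n = N + 1 := ⟨n - 1, by omega⟩
  have := isAddHaarMeasure_volume_matrixPair (n := N + 1) (m₁ := m₁) (m₂ := m₂)
  let e : ((Fin (N + 1) → Fin m₁ → ℂ) × (Fin (N + 1) → Fin m₂ → ℂ)) ≃ₗ[ℝ]
      ((Fin (N + 1) → Fin m₁ → ℂ) × (Fin (N + 1) → Fin m₂ → ℂ)) :=
    LinearEquiv.prodCongr ((ZMod.dft (N := N + 1) (E := Fin m₁ → ℂ)).restrictScalars ℝ)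
      ((ZMod.dft (N := N + 1) (E := Fin m₂ → ℂ)).restrictScalars ℝ)
  filter_upwards [ae_comp_linearEquiv volume e (ae_fourierIdentifiable hs hx₀ hy₀)] with p hp
  exact FourierIdentifiable.identifiable hp

theorem subspaceSet_eq_sparseSet (m : ℕ) : subspaceSet m = sparseSet m m := by
  ext x
  simpa [subspaceSet, sparseSet] using (hammingNorm_le_card_fintype (x := x))

end BlindDeconv

theorem theorem1 (n m₁ m₂ s₁ s₂ : ℕ) :
    -- subspace constraints
    (m₁ + m₂ < n → BlindDeconv.GenericallyWeaklyIdentifiable n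
      (BlindDeconv.subspaceSet m₁) (BlindDeconv.subspaceSet m₂)) ∧
    -- mixed constraints
    (s₁ + m₂ < n → BlindDeconv.GenericallyWeaklyIdentifiable n
      (BlindDeconv.sparseSet m₁ s₁) (BlindDeconv.subspaceSet m₂)) ∧
    -- sparsity constraints
    (s₁ + s₂ < n → BlindDeconv.GenericallyWeaklyIdentifiable n
      (BlindDeconv.sparseSet m₁ s₁) (BlindDeconv.sparseSet m₂ s₂)) := by
  simp only [BlindDeconv.subspaceSet_eq_sparseSet]
  exact ⟨BlindDeconv.genericallyWeaklyIdentifiable_sparseSet,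
    BlindDeconv.genericallyWeaklyIdentifiable_sparseSet,
    BlindDeconv.genericallyWeaklyIdentifiable_sparseSet⟩
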